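/- **Setting.** There are $n=2f+1$ replicas, of which at most $f$ crash (at some time, for good); a replica that never crashes is *correct*, and every replica follows the protocol below as long as it has not crashed. Steps are asynchronous. Links between correct replicas are reliable (every message sent is eventually received); other messages may be delayed arbitrarily or lost. *Blocks and dissemination.* Replicas propose one block in each of the rounds $1,2,3,\dots$ and send it to all replicas. A block carries its author, its round, a list of transactions, and references to blocks of earlier rounds. When a replica receives a block, it requests from the sender every referenced block that is missing from its *local DAG*, and such requests are answered by replicas that have the block; a received block is added to the local DAG once all blocks it references are there. Fix $1\le\ell\le n$ and an enumeration $N_0,\dots,N_{n-1}$ of the replicas. The *skeleton slots* of round $r$ are, in this order, those of the replicas $N_{(r+k)\bmod n}$, $k=0,\dots,\ell-1$; slots are ordered by round first. A replica that has last proposed in round $r\ge 1$ may propose in round $r+1$ when its local DAG contains its own block of round $r$, at least $f+1$ blocks of round $r$, and either all skeleton blocks of round $r$ or its timeout has expired. The new block references its own previous block, the first $f+1$ blocks of round $r$ that entered its local DAG, and possibly further blocks of its local DAG of earlier rounds; blocks of round $1$ have no references. Correct replicas eventually propose when they may, eventually add blocks that can be added, and their timeouts eventually expire. *Decision rule.*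 Given a local DAG, each skeleton slot up to its highest round is classified, from the highest slot to the lowest. A slot of round $r$ is *committed* with its block $B$ if at least $f+1$ blocks of round $r+1$ in the DAG reference $B$. Otherwise let the *anchor* be the first slot of round $>r+1$ that is not skipped. If the anchor exists and is committed with a block $A$, then the slot is committed with its block $B$ if $B$ is in the DAG and there is a path of references from $A$ to $B$, and it is *skipped* if not. In all other cases it is *undecided*. A replica *commits* a block $B$ if, at some time, there is in its local DAG a slot that is committed with a block $L$, all lower slots are decided, and there is a (possibly trivial) path from $L$ to $B$. *Random asynchronous model.* Message delivery follows a random schedule: there are independent, uniformly random linear orders $\pi_{p,r}$ of the replicas, one for each replica $p$ and round $r$, such that almost surely, for all $p$ and $r$, whenever at least $f+1$ blocks of round $r$ have entered the local DAG of $p$, the first $f+1$ of them are those whose authors come first in the order $\pi_{p,r}$ among the authors of all round-$r$ blocks that ever enter the local DAG of $p$. Apart from this, crashes, delays, timeouts, transactions and additional references are arbitrary and may depend on the randomness. **Theorem (Agreement).** In the random asynchronous model, with probability $1$: for every block $B$, if some correct replica commits $B$, then every correct replica eventually commits $B$. -/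

import Mathlib

open MeasureTheory ProbabilityTheory

/-- Parameters of the protocol: the fault bound `f` (there are `2 f + 1` replicas), the number of
skeleton slots per round, and the enumeration `nodes` of the replicas used to assign leaders. -/
structure Config where
  f : ℕ
  leadersPerRound : ℕ
  one_le_leaders : 1 ≤ leadersPerRound
  leaders_le : leadersPerRound ≤ 2 * f + 1
  nodes : Fin (2 * f + 1) ≃ Fin (2 * f + 1)

/-- The `n = 2 f + 1` replicas. -/
abbrev Config.Replica (c : Config) : Type := Fin (2 * c.f + 1)

/-- A pair (replica, round). It names a slot and serves as a reference to a block: a replica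
proposes at most one block per round. -/
abbrev Config.Ref (c : Config) : Type := c.Replica × ℕ

/-- The replica to which the skeleton slot of rank `k` of round `r` belongs. -/
def Config.leader (c : Config) (r k : ℕ) : c.Replica :=
  c.nodes ⟨(r + k) % (2 * c.f + 1), Nat.mod_lt _ (Nat.succ_pos _)⟩

/-- A block: author, round, transactions, and references to earlier blocks. Rounds start at `1`. -/
@[ext] structure Block (c : Config) (Tx : Type*) where
  author : c.Replica
  round : ℕ
  txs : List Tx
  parents : Finset c.Ref

/-- The reference by which other blocks point to `b`. -/
def Block.ref {c : Config} {Tx : Type*} (b : Block c Tx) : c.Ref := (b.author, b.round)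

/-! ### The decision rule, as a function of a local DAG -/

section Decider

variable {c : Config} {Tx : Type*}

/-- There is a path in the DAG `D` from `bnew` to `bold` (possibly of length `0`), that is,
`bold` is in the causal history of `bnew`. -/
def IsLink (D : Finset (Block c Tx)) (bnew bold : Block c Tx) : Prop :=
  Relation.ReflTransGen (fun b b' => b ∈ D ∧ b' ∈ D ∧ b'.ref ∈ b.parents) bnew bold

open Classical in
/-- The block of the DAG `D` in the skeleton slot of rank `k` of round `r`, if there is one. -/
noncomputable def leaderBlock (D : Finset (Block c Tx)) (r k : ℕ) : Option (Block c Tx) :=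
  if h : ∃ b ∈ D, b.round = r ∧ b.author = c.leader r k then some h.choose else none

/-- A wave has two rounds: the wave that proposes in round `r` decides in round `r + 1`. -/
def decisionRound (r : ℕ) : ℕ := r + 1

open Classical in
/-- At least `f + 1` blocks of the decision round in `D` link to the leader block `b` of
round `r`. -/
def SupportedLeader (D : Finset (Block c Tx)) (r : ℕ) (b : Block c Tx) : Prop :=
  c.f + 1 ≤ (D.filter fun b' => b'.round = decisionRound r ∧ IsLink D b' b).card

/-- The states of a slot. -/
inductive Decision (c : Config) (Tx : Type*) where
  | undecided : Decision c Tx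
  | skip : Decision c Tx
  | commit (b : Block c Tx) : Decision c Tx

/-- A skeleton slot, given by its round and its rank in the round, with its state. -/
structure SlotDecision (c : Config) (Tx : Type*) where
  round : ℕ
  rank : ℕ
  decision : Decision c Tx

open Classical in
/-- The direct decision rule. -/
noncomputable def tryDirectDecide (D : Finset (Block c Tx)) (r k : ℕ) : Decision c Tx :=
  match leaderBlock D r k with
  | some b => if SupportedLeader D r b then .commit b else .undecided
  | none => .undecided

open Classical in
/-- The anchor of a slot of round `r`: the first slot after the decision round of `r` that is not
skipped. The list `S` holds the higher slots, in increasing order. -/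
noncomputable def anchor (r : ℕ) (S : List (SlotDecision c Tx)) : Option (SlotDecision c Tx) :=
  S.find? fun s => decide (decisionRound r < s.round ∧ s.decision ≠ .skip)

/-- The state that an anchor in state `d` imposes on the slot of rank `k` of round `r`. -/
noncomputable def decideFromAnchor (D : Finset (Block c Tx)) (r k : ℕ) :
    Decision c Tx → Decision c Tx
  | .commit a =>
    match leaderBlock D r k with
    | some b => open Classical in if IsLink D a b then .commit b else .skip
    | none => .skip
  | _ => .undecided

/-- The indirect decision rule. -/
noncomputable def tryIndirectDecide (D : Finset (Block c Tx)) (r k : ℕ)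
    (S : List (SlotDecision c Tx)) : Decision c Tx :=
  match anchor r S with
  | some s => decideFromAnchor D r k s.decision
  | none => .undecided

/-- The direct rule, then the indirect rule if the direct rule leaves the slot undecided. -/
noncomputable def decideSlot (D : Finset (Block c Tx)) (r k : ℕ)
    (S : List (SlotDecision c Tx)) : Decision c Tx :=
  match tryDirectDecide D r k with
  | .undecided => tryIndirectDecide D r k S
  | d => d

/-- The highest round of a block in `D`. -/
def highestRound (D : Finset (Block c Tx)) : ℕ := D.sup Block.round

/-- The skeleton slots (round, rank) of the rounds `1, …, R`, in increasing order. -/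
def slots (c : Config) (R : ℕ) : List (ℕ × ℕ) :=
  (List.range' 1 R).flatMap fun r => (List.range c.leadersPerRound).map fun k => (r, k)

/-- The states of all skeleton slots up to the highest round of `D`, in increasing order of the
slots; they are computed from the highest slot down to the lowest. -/
noncomputable def tryDecide (D : Finset (Block c Tx)) : List (SlotDecision c Tx) :=
  (slots c (highestRound D)).foldr (fun s S => ⟨s.1, s.2, decideSlot D s.1 s.2 S⟩ :: S) []

/-- The block that a decision commits, if any. -/
def Decision.committed? : Decision c Tx → Option (Block c Tx)
  | .commit b => some b
  | _ => none

open Classical in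
/-- The skeleton blocks output for `D`: those of the committed slots below the first undecided
slot. -/
noncomputable def committedLeaders (D : Finset (Block c Tx)) : List (Block c Tx) :=
  ((tryDecide D).takeWhile fun s => decide (s.decision ≠ .undecided)).filterMap
    fun s => s.decision.committed?

/-- The block `b` belongs to the commit sequence of a replica with local DAG `D`: it is in the
causal history of a committed skeleton block up to which all slots are decided. -/
def CommittedIn (D : Finset (Block c Tx)) (b : Block c Tx) : Prop :=
  b ∈ D ∧ ∃ L ∈ committedLeaders D, IsLink D L b

end Decider

/-! ### The message-passing system -/

/-- Messages: a block, or a request for the block with a given reference. -/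
inductive Message (c : Config) (Tx : Type*) where
  | block (b : Block c Tx) : Message c Tx
  | request (x : c.Ref) : Message c Tx

/-- The state of a replica. `round` is the last round in which it proposed (`0` at the start),
`timedOut` tells whether the timeout has expired since then, `store` holds the blocks received so
far, and `log` lists the blocks of the local DAG in the order in which they were added. -/
structure LocalState (c : Config) (Tx : Type*) where
  crashed : Prop
  round : ℕ
  timedOut : Prop
  store : Set (Block c Tx)
  log : List (Block c Tx)

section System

variable {c : Config} {Tx : Type*}

/-- The local DAG contains a block with reference `x`. -/
def LocalState.Has (l : LocalState c Tx) (x : c.Ref) : Prop := ∃ b ∈ l.log, b.ref = x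

/-- The blocks of round `r` in the local DAG, in the order in which they were added. -/
def LocalState.roundLog (l : LocalState c Tx) (r : ℕ) : List (Block c Tx) :=
  l.log.filter fun b => b.round = r

open Classical in
/-- The local DAG as a finite set of blocks. -/
noncomputable def LocalState.dag (l : LocalState c Tx) : Finset (Block c Tx) := l.log.toFinset

/-- Replica `p` may propose its next block: this is its first block, or its local DAG contains
its own previous block, at least `f + 1` blocks of that round, and all skeleton blocks of that
round unless the timeout has expired. -/
def LocalState.Ready (l : LocalState c Tx) (p : c.Replica) : Prop :=
  l.round = 0 ∨
    (l.Has (p, l.round) ∧ c.f + 1 ≤ (l.roundLog l.round).length ∧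
      ((∀ k < c.leadersPerRound, l.Has (c.leader l.round k, l.round)) ∨ l.timedOut))

/-- `b` is a legal next block of replica `p`. It refers to `p`'s previous block, to (at least) the
first `f + 1` blocks of the previous round that entered the local DAG, and otherwise to arbitrary
blocks of earlier rounds in the local DAG. Blocks of round `1` have no references. -/
def LocalState.Legal (l : LocalState c Tx) (p : c.Replica) (b : Block c Tx) : Prop :=
  b.author = p ∧ b.round = l.round + 1 ∧
    (l.round ≠ 0 → (p, l.round) ∈ b.parents ∧
      ∀ b' ∈ (l.roundLog l.round).take (c.f + 1), b'.ref ∈ b.parents) ∧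
    ∀ x ∈ b.parents, x.2 < b.round ∧ l.Has x

/-- A received block can be added to the local DAG: all blocks it refers to are in there. -/
def LocalState.CanAdd (l : LocalState c Tx) (b : Block c Tx) : Prop :=
  b ∈ l.store ∧ b ∉ l.log ∧ ∀ x ∈ b.parents, l.Has x

end System

/-- A global state: the local states, and the set of all (sender, recipient, message) sent so
far, each of which may be delivered at any later time. -/
structure GlobalState (c : Config) (Tx : Type*) where
  loc : c.Replica → LocalState c Tx
  sent : Set (c.Replica × c.Replica × Message c Tx)

/-- The steps of the system. `receive p q m` is the receipt by `p` of the message `m` of `q`. -/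
inductive Step (c : Config) (Tx : Type*) where
  | propose (p : c.Replica) (b : Block c Tx) : Step c Tx
  | receive (p q : c.Replica) (m : Message c Tx) : Step c Tx
  | add (p : c.Replica) (b : Block c Tx) : Step c Tx
  | timeout (p : c.Replica) : Step c Tx
  | crash (p : c.Replica) : Step c Tx

section Steps

variable {c : Config} {Tx : Type*}

/-- The initial state. -/
def GlobalState.init (c : Config) (Tx : Type*) : GlobalState c Tx where
  loc _ := { crashed := False, round := 0, timedOut := False, store := ∅, log := [] }
  sent := ∅

/-- The replica that performs a step. -/
def Step.actor : Step c Tx → c.Replica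
  | .propose p _ => p
  | .receive p _ _ => p
  | .add p _ => p
  | .timeout p => p
  | .crash p => p

/-- The precondition of a step, apart from the condition that the replica has not crashed. -/
def GlobalState.Guard (s : GlobalState c Tx) : Step c Tx → Prop
  | .propose p b => (s.loc p).Ready p ∧ (s.loc p).Legal p b
  | .receive p q m => (q, p, m) ∈ s.sent
  | .add p b => (s.loc p).CanAdd b
  | .timeout _ => True
  | .crash _ => True

/-- The effect of a step on the local state of the replica that performs it. -/
def LocalState.next (l : LocalState c Tx) : Step c Tx → LocalState c Tx
  | .propose _ b => { l with round := b.round, timedOut := False }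
  | .receive _ _ (.block b) => { l with store := insert b l.store }
  | .receive _ _ (.request _) => l
  | .add _ b => { l with log := l.log ++ [b] }
  | .timeout _ => { l with timedOut := True }
  | .crash _ => { l with crashed := True }

/-- The messages sent in a step by a replica in local state `l`. A new block goes to all replicas
(the author included); the receipt of a block triggers requests, to the sender, for all blocks it
refers to that are not in the local DAG; a request is answered with the requested block. -/
def LocalState.outbox (l : LocalState c Tx) :
    Step c Tx → Set (c.Replica × c.Replica × Message c Tx)
  | .propose p b => {e | ∃ q, e = (p, q, .block b)}
  | .receive p q (.block b) => {e | ∃ x ∈ b.parents, ¬ l.Has x ∧ e = (p, q, .request x)}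
  | .receive p q (.request x) => {e | ∃ b ∈ l.log, b.ref = x ∧ e = (p, q, .block b)}
  | .add _ _ => ∅
  | .timeout _ => ∅
  | .crash _ => ∅

/-- The global state after a step. -/
def GlobalState.next (s : GlobalState c Tx) (a : Step c Tx) : GlobalState c Tx where
  loc := Function.update s.loc a.actor ((s.loc a.actor).next a)
  sent := s.sent ∪ (s.loc a.actor).outbox a

end Steps

/-- An infinite execution, as a sequence of steps from the initial state. At most `f` replicas
crash. Links between correct replicas are reliable; other messages may be delayed arbitrarily or
lost. Correct replicas eventually perform the steps that they are bound to perform. -/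
structure Execution (c : Config) (Tx : Type*) where
  state : ℕ → GlobalState c Tx
  action : ℕ → Step c Tx
  state_zero : state 0 = GlobalState.init c Tx
  alive : ∀ t, ¬ ((state t).loc (action t).actor).crashed
  guard : ∀ t, (state t).Guard (action t)
  state_succ : ∀ t, state (t + 1) = (state t).next (action t)
  faults : {p | ∃ t, ((state t).loc p).crashed}.ncard ≤ c.f
  /-- Reliable links: every message sent in a step is received in a later step. -/
  delivery : ∀ p q m t, (∀ s, ¬ ((state s).loc p).crashed) → (∀ s, ¬ ((state s).loc q).crashed) →
    (p, q, m) ∈ ((state t).loc (action t).actor).outbox (action t) →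
    ∃ t' > t, action t' = .receive q p m
  /-- A block with complete causal history is eventually added to the local DAG. -/
  adding : ∀ p b t, (∀ s, ¬ ((state s).loc p).crashed) → ((state t).loc p).CanAdd b →
    ∃ t' ≥ t, b ∈ ((state t').loc p).log
  /-- Timeouts expire. -/
  timing : ∀ p t, (∀ s, ¬ ((state s).loc p).crashed) →
    ∃ t' ≥ t, ((state t').loc p).timedOut ∨ ((state t).loc p).round < ((state t').loc p).round
  /-- A replica that is ready to propose eventually proposes. -/
  proposing : ∀ p t, (∀ s, ¬ ((state s).loc p).crashed) → ((state t).loc p).Ready p →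
    ∃ t' ≥ t, ((state t).loc p).round < ((state t').loc p).round

namespace Execution

variable {c : Config} {Tx : Type*}

/-- A replica is correct if it never crashes. -/
def Correct (E : Execution c Tx) (p : c.Replica) : Prop := ∀ t, ¬ ((E.state t).loc p).crashed

/-- Replica `p` commits the block `b` at some time. -/
def Commits (E : Execution c Tx) (p : c.Replica) (b : Block c Tx) : Prop :=
  ∃ t, CommittedIn ((E.state t).loc p).dag b

open Classical in
/-- The authors of the blocks of round `r` that replica `p` ever receives, that is, that ever
enter the local DAG of `p`. -/
noncomputable def authors (E : Execution c Tx) (p : c.Replica) (r : ℕ) : Finset c.Replica :=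
  Finset.univ.filter fun x => ∃ t, ((E.state t).loc p).Has (x, r)

/-- The receipts follow the schedule `π`, where `π p r x` is the rank of `x` in a linear order of
the replicas: for all `p` and `r`, the first `f + 1` blocks of round `r` received by `p` are those
whose authors come first in the order `π p r` among the authors of all blocks of round `r` that `p`
ever receives. -/
def Follows (E : Execution c Tx) (π : c.Replica → ℕ → Equiv.Perm c.Replica) : Prop :=
  ∀ p r t, c.f + 1 ≤ (((E.state t).loc p).roundLog r).length →
    (((((E.state t).loc p).roundLog r).take (c.f + 1)).map Block.author).toFinset =
      (E.authors p r).filter fun x =>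
        ((E.authors p r).filter fun y => π p r y < π p r x).card < c.f + 1

end Execution

/-- A random schedule: the linear orders `π p r` are independent and uniformly distributed. -/
structure IsRandomSchedule (c : Config) {Ω : Type*} [MeasurableSpace Ω] (μ : Measure Ω)
    (π : c.Replica → ℕ → Ω → Equiv.Perm c.Replica) : Prop where
  measurable : ∀ p r, Measurable[_, ⊤] (π p r)
  uniform : ∀ p r e, μ {ω | π p r ω = e} = (Fintype.card (Equiv.Perm c.Replica) : ENNReal)⁻¹
  indep : iIndepFun (m := fun _ => ⊤) (fun i : c.Replica × ℕ => π i.1 i.2) μ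

/-!
Agreement combines a safety property, which holds in every execution, with a liveness property,
which needs the random schedule.

*Safety.* Blocks are determined by their references, and local DAGs contain the causal histories of
their blocks, so a block has the same causal history everywhere (`IsLink.transfer`). If `f + 1`
blocks of round `r + 1` refer to a leader block of round `r`, every later block has it in its causal
history, because it reaches `f + 1` of the at most `2 f + 1` blocks of round `r + 1`
(`SupportedLeader.isLink`). Hence no anchor contradicts a direct commit, and by downward induction on
the round two local DAGs never decide the same slot differently (`decision_unique`): equal decisions
above a slot lead to equal anchors.

*Liveness.* Safety alone is not enough: a slot decided in one local DAG, thanks to blocks that only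
one replica received before their authors crashed, may stay undecided in another. However, if the
first slots of two consecutive rounds `R` and `R + 1` are committed directly, they serve as anchors
that decide all slots below round `R` (`decided_of_direct`). Together with safety, everything
committed elsewhere through a slot below round `R` is then committed as well
(`CommittedIn.exists_transfer`).

Correct replicas propose in all rounds, and their blocks reach all correct replicas
(`Execution.Correct.exists_round_ge`, `Execution.Correct.eventually_mem_log_of_propose`). Suppose
that the leader of the first slot of round `R` is correct and comes first in the orders `π p R` of
all replicas `p`. Then each correct replica refers to the leader's block in round `R + 1`, and these
`f + 1` references directly commit the slot at every correct replica
(`Execution.Follows.eventually_tryDirectDecide`). The set of crashed replicas may depend on the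
randomness, but `f + 1` of `2 f + 1` replicas are correct, so two consecutive ones in the enumeration
are (`Execution.exists_consecutive_correct`). It therefore suffices that for each position in the
enumeration there are, almost surely, arbitrarily high pairs of rounds in which the leaders from this
position on come first in all orders. Such pairs use disjoint sets of independent permutations and
have a constant positive probability, so the second Borel–Cantelli lemma applies
(`IsRandomSchedule.exists_favourable_rounds`).
-/

/-! ### Local DAGs and quorum intersection -/

section LocalDags

variable {c : Config} {Tx : Type*}

/-- The properties shared by all sets of blocks that replicas following the protocol can produce:
references name blocks uniquely, rounds start at `1`, references point to earlier rounds, and a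
block of a round after the first refers to at least `f + 1` blocks of the previous round. -/
structure IsHistory (U : Set (Block c Tx)) : Prop where
  ref_inj : Set.InjOn Block.ref U
  round_pos : ∀ b ∈ U, 1 ≤ b.round
  parents_lt : ∀ b ∈ U, ∀ x ∈ b.parents, x.2 < b.round
  quorum : ∀ b ∈ U, 2 ≤ b.round → c.f + 1 ≤ (b.parents.filter fun x => x.2 + 1 = b.round).card

/-- `D` is a part of the history `U` that contains everything its blocks refer to. -/
structure IsLocalDag (U : Set (Block c Tx)) (D : Finset (Block c Tx)) : Prop where
  subset : ∀ b ∈ D, b ∈ U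
  closed : ∀ b ∈ D, ∀ x ∈ b.parents, ∃ b' ∈ D, b'.ref = x

variable {U : Set (Block c Tx)} {D D₁ D₂ : Finset (Block c Tx)}

/-- The causal history of a block is the same in all local DAGs that contain the block. -/
theorem IsLink.transfer (hU : IsHistory U) (h₁ : IsLocalDag U D₁) (h₂ : IsLocalDag U D₂)
    {a b : Block c Tx} (ha : a ∈ D₂) (h : IsLink D₁ a b) : IsLink D₂ a b ∧ b ∈ D₂ := by
  induction h with
  | refl => exact ⟨Relation.ReflTransGen.refl, ha⟩
  | tail _ hs ih =>
    obtain ⟨_, hb', href⟩ := hs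
    obtain ⟨b'', hb'', he⟩ := h₂.closed _ ih.2 _ href
    have := hU.ref_inj (h₂.subset _ hb'') (h₁.subset _ hb') he
    subst this
    exact ⟨ih.1.tail ⟨ih.2, hb'', href⟩, hb''⟩

theorem leaderBlock_eq_some (hU : IsHistory U) (hD : IsLocalDag U D) {r k : ℕ}
    {b : Block c Tx} :
    leaderBlock D r k = some b ↔ b ∈ D ∧ b.round = r ∧ b.author = c.leader r k := by
  unfold leaderBlock
  split_ifs with h
  · have hs := h.choose_spec
    rw [Option.some_inj]
    constructor
    · rintro rfl
      exact hs
    · rintro ⟨hb, hr, ha⟩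
      refine hU.ref_inj (hD.subset _ hs.1) (hD.subset _ hb) ?_
      unfold Block.ref
      rw [hs.2.1, hs.2.2, hr, ha]
  · simp only [false_iff]
    exact fun hb => h ⟨b, hb⟩

/-- Every block has a block of each earlier round `m ≥ 1` in its causal history. -/
theorem exists_link_round (hU : IsHistory U) (hD : IsLocalDag U D) {m : ℕ} (hm : 1 ≤ m)
    {a : Block c Tx} (ha : a ∈ D) (hma : m ≤ a.round) :
    ∃ a' ∈ D, a'.round = m ∧ IsLink D a a' := by
  obtain ⟨d, hd⟩ := Nat.exists_eq_add_of_le hma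
  induction d generalizing a with
  | zero => exact ⟨a, ha, hd, Relation.ReflTransGen.refl⟩
  | succ d ih =>
    have hq := hU.quorum a (hD.subset _ ha) (by omega)
    obtain ⟨x, hx⟩ := Finset.card_pos.1 (lt_of_lt_of_le (Nat.succ_pos _) hq)
    rw [Finset.mem_filter] at hx
    obtain ⟨b, hb, hbx⟩ := hD.closed a ha x hx.1
    have hbr : b.round = x.2 := by rw [← hbx]; rfl
    obtain ⟨a', ha', hr, hl⟩ := ih hb (by omega) (by omega)
    exact ⟨a', ha', hr, Relation.ReflTransGen.head ⟨ha, hb, hbx ▸ hx.1⟩ hl⟩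

/-- Quorum intersection: a leader block with `f + 1` supporters in one local DAG is in the causal
history of every block after the decision round in every other local DAG. -/
theorem SupportedLeader.isLink (hU : IsHistory U) (h₁ : IsLocalDag U D₁) (h₂ : IsLocalDag U D₂)
    {r : ℕ} {a b : Block c Tx} (hs : SupportedLeader D₁ r b)
    (ha : a ∈ D₂) (har : decisionRound r < a.round) : IsLink D₂ a b ∧ b ∈ D₂ := by
  classical
  unfold decisionRound at har
  obtain ⟨a', ha', har', hl⟩ := exists_link_round hU h₂ (m := r + 2) (by omega) ha (by omega)
  have hq := hU.quorum a' (h₂.subset _ ha') (by omega)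
  unfold SupportedLeader at hs
  set V := D₁.filter fun b' => b'.round = decisionRound r ∧ IsLink D₁ b' b with hV
  set P := a'.parents.filter fun x => x.2 + 1 = a'.round with hP
  have hVi : Set.InjOn Block.author (V : Set (Block c Tx)) := by
    intro v hv w hw hvw
    simp only [hV, Finset.coe_filter, Set.mem_ofPred_eq] at hv hw
    refine hU.ref_inj (h₁.subset _ hv.1) (h₁.subset _ hw.1) ?_
    unfold Block.ref
    rw [hvw, hv.2.1, hw.2.1]
  have hPi : Set.InjOn Prod.fst (P : Set c.Ref) := by
    intro v hv w hw hvw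
    simp only [hP, Finset.coe_filter, Set.mem_ofPred_eq] at hv hw
    exact Prod.ext hvw (by omega)
  have hnd : ¬ Disjoint (V.image Block.author) (P.image Prod.fst) := by
    intro hd
    have h := Finset.card_union_of_disjoint hd
    rw [Finset.card_image_of_injOn hVi, Finset.card_image_of_injOn hPi] at h
    have h' := Finset.card_le_univ (V.image Block.author ∪ P.image Prod.fst)
    rw [Fintype.card_fin] at h'
    convert_to c.f + 1 ≤ V.card at hs
    convert_to c.f + 1 ≤ P.card at hq
    omega
  obtain ⟨y, hyV, hyP⟩ := Finset.not_disjoint_iff.1 hnd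
  obtain ⟨v, hv, hvy⟩ := Finset.mem_image.1 hyV
  obtain ⟨x, hx, hxy⟩ := Finset.mem_image.1 hyP
  rw [hV, Finset.mem_filter] at hv
  rw [hP, Finset.mem_filter] at hx
  obtain ⟨v', hv', hvx⟩ := h₂.closed a' ha' x hx.1
  have hvv : v' = v := by
    refine hU.ref_inj (h₂.subset _ hv') (h₁.subset _ hv.1) ?_
    rw [hvx]
    refine Prod.ext (hxy.trans hvy.symm) ?_
    have h1 : v.ref.2 = r + 1 := hv.2.1
    rw [h1]
    omega
  subst hvv
  obtain ⟨hl', hb⟩ := hv.2.2.transfer hU h₁ h₂ hv'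
  exact ⟨(hl.tail ⟨ha', hv', hvx ▸ hx.1⟩).trans hl', hb⟩

end LocalDags

/-! ### The states of the slots -/

section SlotStates

variable {c : Config} {Tx : Type*} {U : Set (Block c Tx)} {D D₁ D₂ : Finset (Block c Tx)}

theorem tryDirectDecide_cases (D : Finset (Block c Tx)) (r k : ℕ) :
    (∃ b, leaderBlock D r k = some b ∧ SupportedLeader D r b ∧
      tryDirectDecide D r k = .commit b) ∨ tryDirectDecide D r k = .undecided := by
  unfold tryDirectDecide
  cases h : leaderBlock D r k with
  | none => exact Or.inr rfl
  | some b =>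
    by_cases hb : SupportedLeader D r b
    · exact Or.inl ⟨b, rfl, hb, by simp [hb]⟩
    · exact Or.inr (by simp [hb])

theorem decideSlot_of_direct {r k : ℕ} {b : Block c Tx} (S : List (SlotDecision c Tx))
    (h : tryDirectDecide D r k = .commit b) : decideSlot D r k S = .commit b := by
  simp [decideSlot, h]

theorem decideSlot_of_undecided {r k : ℕ} (S : List (SlotDecision c Tx))
    (h : tryDirectDecide D r k = .undecided) :
    decideSlot D r k S = tryIndirectDecide D r k S := by
  simp [decideSlot, h]

theorem tryIndirectDecide_eq {r k : ℕ} {S : List (SlotDecision c Tx)}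
    (h : tryIndirectDecide D r k S ≠ .undecided) :
    ∃ s a, anchor r S = some s ∧ s.decision = .commit a ∧
      tryIndirectDecide D r k S = decideFromAnchor D r k (.commit a) := by
  unfold tryIndirectDecide at h ⊢
  cases hs : anchor r S with
  | none => simp [hs] at h
  | some s =>
    simp only [hs] at h ⊢
    cases hd : s.decision with
    | undecided => simp [hd, decideFromAnchor] at h
    | skip => simp [hd, decideFromAnchor] at h
    | commit a => exact ⟨s, a, rfl, hd, rfl⟩

theorem decideFromAnchor_commit (D : Finset (Block c Tx)) (r k : ℕ) (a : Block c Tx) :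
    (∃ b, leaderBlock D r k = some b ∧ IsLink D a b ∧
      decideFromAnchor D r k (.commit a) = .commit b) ∨
    ((∀ b, leaderBlock D r k = some b → ¬ IsLink D a b) ∧
      decideFromAnchor D r k (.commit a) = .skip) := by
  unfold decideFromAnchor
  cases h : leaderBlock D r k with
  | none => exact Or.inr ⟨by simp, rfl⟩
  | some b =>
    by_cases hb : IsLink D a b
    · exact Or.inl ⟨b, rfl, hb, by simp [hb]⟩
    · exact Or.inr ⟨by simpa using hb, by simp [hb]⟩

theorem leaderBlock_of_decideSlot {r k : ℕ} {S : List (SlotDecision c Tx)} {b : Block c Tx}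
    (h : decideSlot D r k S = .commit b) : leaderBlock D r k = some b := by
  rcases tryDirectDecide_cases D r k with ⟨b', hb', -, hd⟩ | hu
  · rw [decideSlot_of_direct S hd] at h
    cases h
    exact hb'
  · rw [decideSlot_of_undecided S hu] at h
    obtain ⟨s, a, -, -, he⟩ := tryIndirectDecide_eq (D := D) (S := S) (r := r) (k := k)
      (by rw [h]; simp)
    rw [he] at h
    rcases decideFromAnchor_commit D r k a with ⟨b', hb', -, hd⟩ | ⟨-, hd⟩
    · rw [hd] at h
      cases h
      exact hb'
    · rw [hd] at h
      cases h

/-- Only the slots after the decision round matter for the state of a slot. -/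
theorem decideSlot_cons {r k : ℕ} {s : SlotDecision c Tx} (S : List (SlotDecision c Tx))
    (h : s.round ≤ decisionRound r) : decideSlot D r k (s :: S) = decideSlot D r k S := by
  have : anchor r (s :: S) = anchor r S := by
    unfold anchor
    rw [List.find?_cons_of_neg]
    simp only [decide_eq_true_eq, not_and]
    omega
  simp only [decideSlot, tryIndirectDecide, this]

/-- The order of the slots: by round, then by rank. -/
def SlotDecision.Before (s s' : SlotDecision c Tx) : Prop :=
  s.round < s'.round ∨ s.round = s'.round ∧ s.rank < s'.rank

theorem mem_slots {R : ℕ} {x : ℕ × ℕ} :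
    x ∈ slots c R ↔ 1 ≤ x.1 ∧ x.1 ≤ R ∧ x.2 < c.leadersPerRound := by
  obtain ⟨r, k⟩ := x
  simp only [slots, List.mem_flatMap, List.mem_range'_1, List.mem_map, List.mem_range,
    Prod.mk.injEq]
  constructor
  · rintro ⟨r', h, k', hk, rfl, rfl⟩
    omega
  · rintro ⟨h1, h2, h3⟩
    exact ⟨r, by omega, k, h3, rfl, rfl⟩

theorem slots_pairwise (c : Config) (R : ℕ) :
    (slots c R).Pairwise fun x y => x.1 < y.1 ∨ x.1 = y.1 ∧ x.2 < y.2 := by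
  unfold slots
  rw [List.pairwise_flatMap]
  constructor
  · intro r _
    rw [List.pairwise_map]
    exact List.pairwise_lt_range.imp fun h => Or.inr ⟨rfl, h⟩
  · refine (List.pairwise_lt_range' (s := 1) (n := R)).imp fun {r r'} h => ?_
    simp only [List.mem_map]
    rintro _ ⟨k, -, rfl⟩ _ ⟨k', -, rfl⟩
    exact Or.inl h

theorem map_foldr_decideSlot (D : Finset (Block c Tx)) (l : List (ℕ × ℕ)) :
    (l.foldr (fun s S => (⟨s.1, s.2, decideSlot D s.1 s.2 S⟩ : SlotDecision c Tx) :: S) []).map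
      (fun s => (s.round, s.rank)) = l := by
  induction l with
  | nil => rfl
  | cons x l ih => rw [List.foldr_cons, List.map_cons, ih]

theorem map_tryDecide (D : Finset (Block c Tx)) :
    (tryDecide D).map (fun s => (s.round, s.rank)) = slots c (highestRound D) :=
  map_foldr_decideSlot D _

theorem tryDecide_pairwise (D : Finset (Block c Tx)) :
    (tryDecide D).Pairwise SlotDecision.Before := by
  have h := slots_pairwise c (highestRound D)
  rw [← map_tryDecide D, List.pairwise_map] at h
  exact h

theorem round_rank_of_mem_tryDecide {s : SlotDecision c Tx} (hs : s ∈ tryDecide D) :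
    1 ≤ s.round ∧ s.round ≤ highestRound D ∧ s.rank < c.leadersPerRound := by
  have : (s.round, s.rank) ∈ slots c (highestRound D) := by
    rw [← map_tryDecide D]
    exact List.mem_map_of_mem hs
  exact mem_slots.1 this

theorem exists_mem_tryDecide {r k : ℕ} (h₁ : 1 ≤ r) (h₂ : r ≤ highestRound D)
    (hk : k < c.leadersPerRound) : ∃ s ∈ tryDecide D, s.round = r ∧ s.rank = k := by
  have : (r, k) ∈ (tryDecide D).map (fun s => (s.round, s.rank)) := by
    rw [map_tryDecide D]
    exact mem_slots.2 ⟨h₁, h₂, hk⟩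
  obtain ⟨s, hs, he⟩ := List.mem_map.1 this
  exact ⟨s, hs, congrArg Prod.fst he, congrArg Prod.snd he⟩

/-- The decision rule may be applied to the list of all slots instead of the higher ones: this
turns the downward recursion into an equation that all states satisfy. -/
theorem decision_of_mem_tryDecide {s : SlotDecision c Tx} (hs : s ∈ tryDecide D) :
    s.decision = decideSlot D s.round s.rank (tryDecide D) := by
  have key : ∀ l : List (ℕ × ℕ), l.Pairwise (fun x y => x.1 < y.1 ∨ x.1 = y.1 ∧ x.2 < y.2) →
      ∀ s ∈ l.foldr (fun s S => (⟨s.1, s.2, decideSlot D s.1 s.2 S⟩ : SlotDecision c Tx) :: S) [],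
        s.decision = decideSlot D s.round s.rank
          (l.foldr (fun s S => (⟨s.1, s.2, decideSlot D s.1 s.2 S⟩ : SlotDecision c Tx) :: S)
            []) := by
    intro l
    induction l with
    | nil => simp
    | cons x l ih =>
      intro hl s hs
      rw [List.pairwise_cons] at hl
      rw [List.foldr_cons] at hs ⊢
      rcases List.mem_cons.1 hs with rfl | hs
      · refine (decideSlot_cons _ ?_).symm
        exact Nat.le_succ _
      · rw [decideSlot_cons]
        · exact ih hl.2 s hs
        · have hm := List.mem_map_of_mem (f := fun s => (s.round, s.rank)) hs
          rw [map_foldr_decideSlot] at hm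
          have := hl.1 _ hm
          simp only [decisionRound] at this ⊢
          omega
  exact key _ (slots_pairwise c _) s hs

/-- The anchor is the lowest slot after the decision round that is not skipped. -/
theorem anchor_spec {r : ℕ} {a : SlotDecision c Tx} (h : anchor r (tryDecide D) = some a) :
    a ∈ tryDecide D ∧ decisionRound r < a.round ∧ a.decision ≠ .skip ∧
      ∀ s ∈ tryDecide D, decisionRound r < s.round → s.decision ≠ .skip → s = a ∨ a.Before s := by
  unfold anchor at h
  obtain ⟨hp, as, bs, heq, hn⟩ := List.find?_eq_some_iff_append.1 h
  simp only [decide_eq_true_eq] at hp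
  refine ⟨by rw [heq]; simp, hp.1, hp.2, fun s hs hr hd => ?_⟩
  have hpw := tryDecide_pairwise D
  rw [heq] at hs hpw
  rcases List.mem_append.1 hs with hs | hs
  · have := hn s hs
    simp [hr, hd] at this
  · rcases List.mem_cons.1 hs with rfl | hs
    · exact Or.inl rfl
    · exact Or.inr ((List.pairwise_cons.1 (List.pairwise_append.1 hpw).2.1).1 s hs)

theorem exists_anchor {r : ℕ} {s : SlotDecision c Tx} (hs : s ∈ tryDecide D)
    (hr : decisionRound r < s.round) (hd : s.decision ≠ .skip) :
    ∃ a, anchor r (tryDecide D) = some a := by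
  unfold anchor
  rw [← Option.isSome_iff_exists, List.find?_isSome]
  exact ⟨s, hs, by simp [hr, hd]⟩

theorem mem_of_decision_commit (hU : IsHistory U) (hD : IsLocalDag U D) {s : SlotDecision c Tx}
    (hs : s ∈ tryDecide D) {b : Block c Tx} (h : s.decision = .commit b) :
    b ∈ D ∧ b.round = s.round ∧ b.author = c.leader s.round s.rank := by
  rw [decision_of_mem_tryDecide hs] at h
  exact (leaderBlock_eq_some hU hD).1 (leaderBlock_of_decideSlot h)

/-! ### Two local DAGs never decide a slot differently -/

/-- A direct commit in one local DAG prevails over any decision in another. -/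
theorem decision_eq_of_direct (hU : IsHistory U) (h₁ : IsLocalDag U D₁) (h₂ : IsLocalDag U D₂)
    {r k : ℕ} {b : Block c Tx} (hb : leaderBlock D₁ r k = some b) (hs : SupportedLeader D₁ r b)
    (hd : decideSlot D₂ r k (tryDecide D₂) ≠ .undecided) :
    decideSlot D₂ r k (tryDecide D₂) = .commit b := by
  have hb' := (leaderBlock_eq_some hU h₁).1 hb
  have same : ∀ b', leaderBlock D₂ r k = some b' → b' = b := by
    intro b' h
    have h := (leaderBlock_eq_some hU h₂).1 h
    refine hU.ref_inj (h₂.subset _ h.1) (h₁.subset _ hb'.1) ?_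
    unfold Block.ref
    rw [h.2.1, h.2.2, hb'.2.1, hb'.2.2]
  rcases tryDirectDecide_cases D₂ r k with ⟨b', hl, -, he⟩ | hu
  · rw [decideSlot_of_direct _ he, same b' hl]
  · rw [decideSlot_of_undecided _ hu] at hd ⊢
    obtain ⟨s, a, han, hsa, he⟩ := tryIndirectDecide_eq hd
    obtain ⟨hsm, hsr, -⟩ := anchor_spec han
    have ha := mem_of_decision_commit hU h₂ hsm hsa
    obtain ⟨hlink, hbD⟩ := hs.isLink hU h₁ h₂ ha.1 (by rw [ha.2.1]; exact hsr)
    rw [he]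
    rcases decideFromAnchor_commit D₂ r k a with ⟨b', hl, -, he'⟩ | ⟨hn, -⟩
    · rw [he', same b' hl]
    · exact absurd hlink (hn b ((leaderBlock_eq_some hU h₂).2 ⟨hbD, hb'.2⟩))

theorem SlotDecision.before_trichotomy (s s' : SlotDecision c Tx) :
    s.Before s' ∨ s'.Before s ∨ s.round = s'.round ∧ s.rank = s'.rank := by
  unfold SlotDecision.Before
  omega

/-- Of two anchors, the earlier one is not skipped in its own local DAG, hence not in the other
one either if decided states agree; so it is not earlier. -/
theorem not_anchor_before {r : ℕ} {s₁ s₂ : SlotDecision c Tx}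
    {a₁ : Block c Tx} (h₁ : anchor r (tryDecide D₁) = some s₁) (hd₁ : s₁.decision = .commit a₁)
    (h₂ : anchor r (tryDecide D₂) = some s₂)
    (agree : ∀ s ∈ tryDecide D₂, s.round = s₁.round → s.rank = s₁.rank →
      s.decision ≠ .undecided → s.decision = s₁.decision) : ¬ s₁.Before s₂ := by
  intro hb
  obtain ⟨hm₁, hr₁, -, -⟩ := anchor_spec h₁
  obtain ⟨hm₂, -, -, hf₂⟩ := anchor_spec h₂
  have hrange := round_rank_of_mem_tryDecide hm₁
  have hrange₂ := round_rank_of_mem_tryDecide hm₂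
  have hle : s₁.round ≤ s₂.round := by
    unfold SlotDecision.Before at hb
    omega
  obtain ⟨s, hs, hsr, hsk⟩ := exists_mem_tryDecide (D := D₂) hrange.1
    (hle.trans hrange₂.2.1) hrange.2.2
  have hskip : s.decision = .skip := by
    by_contra hne
    rcases hf₂ s hs (by rw [hsr]; exact hr₁) hne with rfl | hlt
    · unfold SlotDecision.Before at hb
      omega
    · unfold SlotDecision.Before at hb hlt
      omega
  have := agree s hs hsr hsk (by rw [hskip]; simp)
  rw [hskip, hd₁] at this
  cases this

theorem decision_unique (hU : IsHistory U) (h₁ : IsLocalDag U D₁) (h₂ : IsLocalDag U D₂)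
    {s₁ s₂ : SlotDecision c Tx} (hm₁ : s₁ ∈ tryDecide D₁) (hm₂ : s₂ ∈ tryDecide D₂)
    (hr : s₁.round = s₂.round) (hk : s₁.rank = s₂.rank)
    (hd₁ : s₁.decision ≠ .undecided) (hd₂ : s₂.decision ≠ .undecided) :
    s₁.decision = s₂.decision := by
  -- Downward induction on the round: the anchors of a slot are in higher rounds.
  induction hn : highestRound D₁ - s₁.round using Nat.strong_induction_on
    generalizing s₁ s₂ with
  | _ n ih =>
  subst hn
  have e₁ := decision_of_mem_tryDecide hm₁
  have e₂ := decision_of_mem_tryDecide hm₂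
  rw [← hr, ← hk] at e₂
  rw [e₁] at hd₁ ⊢
  rw [e₂] at hd₂ ⊢
  rcases tryDirectDecide_cases D₁ s₁.round s₁.rank with ⟨b, hl, hs, he⟩ | hu₁
  · rw [decideSlot_of_direct _ he, decision_eq_of_direct hU h₁ h₂ hl hs hd₂]
  rcases tryDirectDecide_cases D₂ s₁.round s₁.rank with ⟨b, hl, hs, he⟩ | hu₂
  · rw [decideSlot_of_direct _ he, decision_eq_of_direct hU h₂ h₁ hl hs hd₁]
  rw [decideSlot_of_undecided _ hu₁] at hd₁ ⊢
  rw [decideSlot_of_undecided _ hu₂] at hd₂ ⊢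
  obtain ⟨t₁, a₁, ht₁, hc₁, f₁⟩ := tryIndirectDecide_eq hd₁
  obtain ⟨t₂, a₂, ht₂, hc₂, f₂⟩ := tryIndirectDecide_eq hd₂
  obtain ⟨tm₁, tr₁, -, -⟩ := anchor_spec ht₁
  obtain ⟨tm₂, tr₂, -, -⟩ := anchor_spec ht₂
  have g₁ := round_rank_of_mem_tryDecide tm₁
  unfold decisionRound at tr₁ tr₂
  have agree : ∀ u₁ ∈ tryDecide D₁, ∀ u₂ ∈ tryDecide D₂, s₁.round < u₁.round →
      u₁.round = u₂.round → u₁.rank = u₂.rank → u₁.decision ≠ .undecided →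
      u₂.decision ≠ .undecided → u₁.decision = u₂.decision := by
    intro u₁ hu₁ u₂ hu₂ hlt hr hk hn₁ hn₂
    have := round_rank_of_mem_tryDecide hu₁
    exact ih (highestRound D₁ - u₁.round) (by omega) hu₁ hu₂ hr hk hn₁ hn₂ rfl
  have hslot : t₁.round = t₂.round ∧ t₁.rank = t₂.rank := by
    rcases t₁.before_trichotomy t₂ with hb | hb | h
    · exact absurd hb (not_anchor_before ht₁ hc₁ ht₂ fun u hu hur huk hun =>
        (agree t₁ tm₁ u hu (by omega) hur.symm huk.symm (by rw [hc₁]; simp) hun).symm)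
    · exact absurd hb (not_anchor_before ht₂ hc₂ ht₁ fun u hu hur huk hun =>
        agree u hu t₂ tm₂ (by omega) hur huk hun (by rw [hc₂]; simp))
    · exact h
  have haa : a₁ = a₂ := by
    have := agree t₁ tm₁ t₂ tm₂ (by omega) hslot.1 hslot.2 (by rw [hc₁]; simp) (by rw [hc₂]; simp)
    rw [hc₁, hc₂] at this
    injection this
  subst haa
  have m₁ := (mem_of_decision_commit hU h₁ tm₁ hc₁).1
  have m₂ := (mem_of_decision_commit hU h₂ tm₂ hc₂).1
  rw [f₁, f₂]
  rcases decideFromAnchor_commit D₁ s₁.round s₁.rank a₁ with ⟨b₁, l₁, k₁, v₁⟩ | ⟨n₁, v₁⟩ <;>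
    rcases decideFromAnchor_commit D₂ s₁.round s₁.rank a₁ with ⟨b₂, l₂, k₂, v₂⟩ | ⟨n₂, v₂⟩
  · have w₁ := (leaderBlock_eq_some hU h₁).1 l₁
    have w₂ := (leaderBlock_eq_some hU h₂).1 l₂
    have : b₁ = b₂ := by
      refine hU.ref_inj (h₁.subset _ w₁.1) (h₂.subset _ w₂.1) ?_
      unfold Block.ref
      rw [w₁.2.1, w₁.2.2, w₂.2.1, w₂.2.2]
    rw [v₁, v₂, this]
  · obtain ⟨k, hb⟩ := k₁.transfer hU h₁ h₂ m₂
    exact absurd k (n₂ b₁ ((leaderBlock_eq_some hU h₂).2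
      ⟨hb, ((leaderBlock_eq_some hU h₁).1 l₁).2⟩))
  · obtain ⟨k, hb⟩ := k₂.transfer hU h₂ h₁ m₁
    exact absurd k (n₁ b₂ ((leaderBlock_eq_some hU h₁).2
      ⟨hb, ((leaderBlock_eq_some hU h₂).1 l₂).2⟩))
  · rw [v₁, v₂]

/-! ### Two consecutive direct commits decide everything below -/

theorem mem_tryDecide_of_direct (hU : IsHistory U) (hD : IsLocalDag U D) {r k : ℕ}
    {b : Block c Tx} (hk : k < c.leadersPerRound) (h : tryDirectDecide D r k = .commit b) :
    ∃ s ∈ tryDecide D, s.round = r ∧ s.rank = k ∧ s.decision = .commit b := by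
  have hb := (leaderBlock_eq_some hU hD).1
    (leaderBlock_of_decideSlot (decideSlot_of_direct [] h))
  have hr : r ≤ highestRound D := hb.2.1 ▸ Finset.le_sup (f := Block.round) hb.1
  obtain ⟨s, hs, rfl, rfl⟩ := exists_mem_tryDecide (D := D)
    (hb.2.1 ▸ hU.round_pos b (hD.subset _ hb.1)) hr hk
  exact ⟨s, hs, rfl, rfl, by rw [decision_of_mem_tryDecide hs, decideSlot_of_direct _ h]⟩

/-- The first slot of round `R + 1` is the anchor of all slots of round `R - 1`, and the first slot
of round `R` is the last candidate for the anchor of a slot of a lower round. -/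
theorem decided_of_direct (hU : IsHistory U) (hD : IsLocalDag U D) {R : ℕ} {b b' : Block c Tx}
    (h : tryDirectDecide D R 0 = .commit b) (h' : tryDirectDecide D (R + 1) 0 = .commit b')
    {s : SlotDecision c Tx} (hs : s ∈ tryDecide D) (hsR : s.round < R) :
    s.decision ≠ .undecided := by
  obtain ⟨w, hw, hwr, hwk, hwd⟩ := mem_tryDecide_of_direct hU hD c.one_le_leaders h
  obtain ⟨w', hw', hwr', hwk', hwd'⟩ := mem_tryDecide_of_direct hU hD c.one_le_leaders h'
  induction hn : R - s.round using Nat.strong_induction_on generalizing s with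
  | _ n ih =>
  subst hn
  rw [decision_of_mem_tryDecide hs]
  rcases tryDirectDecide_cases D s.round s.rank with ⟨v, -, -, he⟩ | hu
  · rw [decideSlot_of_direct _ he]
    simp
  rw [decideSlot_of_undecided _ hu]
  have main : ∃ t a, anchor s.round (tryDecide D) = some t ∧ t.decision = .commit a := by
    by_cases hc : s.round + 1 < R
    · obtain ⟨t, ht⟩ := exists_anchor hw (r := s.round) (by rw [hwr]; exact hc)
        (by rw [hwd]; simp)
      obtain ⟨tm, tr, td, tf⟩ := anchor_spec ht
      unfold decisionRound at tr tf
      rcases tf w hw (by omega) (by rw [hwd]; simp) with rfl | hlt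
      · exact ⟨_, b, ht, hwd⟩
      · have hlt' : t.round < R := by
          unfold SlotDecision.Before at hlt
          omega
        have hnu := ih (R - t.round) (by omega) tm hlt' rfl
        cases hd : t.decision with
        | undecided => exact absurd hd hnu
        | skip => exact absurd hd td
        | commit a => exact ⟨t, a, ht, hd⟩
    · obtain ⟨t, ht⟩ := exists_anchor hw' (r := s.round) (by unfold decisionRound; omega)
        (by rw [hwd']; simp)
      obtain ⟨tm, tr, td, tf⟩ := anchor_spec ht
      unfold decisionRound at tr tf
      rcases tf w' hw' (by omega) (by rw [hwd']; simp) with rfl | hlt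
      · exact ⟨_, b', ht, hwd'⟩
      · unfold SlotDecision.Before at hlt
        omega
  obtain ⟨t, a, ht, ha⟩ := main
  unfold tryIndirectDecide
  rw [ht]
  simp only [ha]
  rcases decideFromAnchor_commit D s.round s.rank a with ⟨v, -, -, he⟩ | ⟨-, he⟩ <;>
    rw [he] <;> simp

theorem mem_takeWhile_of_sorted {α : Type*} {r : α → α → Prop} {p : α → Bool} {l : List α}
    (hl : l.Pairwise r) {a : α} (ha : a ∈ l) (hp : p a) (h : ∀ x ∈ l, r x a → p x) :
    a ∈ l.takeWhile p := by
  induction l with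
  | nil => simp at ha
  | cons x l ih =>
    rw [List.pairwise_cons] at hl
    rcases List.mem_cons.1 ha with rfl | ha
    · rw [List.takeWhile_cons_of_pos hp]
      exact List.mem_cons_self
    · rw [List.takeWhile_cons_of_pos (h x List.mem_cons_self (hl.1 a ha))]
      exact List.mem_cons_of_mem _ (ih hl.2 ha fun y hy => h y (List.mem_cons_of_mem _ hy))

/-- What is committed in `D₁` through slots below round `R` is committed in each local DAG that
directly commits the first slots of the rounds `R` and `R + 1`. -/
theorem CommittedIn.exists_transfer (hU : IsHistory U) (h₁ : IsLocalDag U D₁) {b : Block c Tx}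
    (h : CommittedIn D₁ b) :
    ∃ r, ∀ R, r < R → ∀ D₂, IsLocalDag U D₂ → (∃ v, tryDirectDecide D₂ R 0 = .commit v) →
      (∃ v, tryDirectDecide D₂ (R + 1) 0 = .commit v) → CommittedIn D₂ b := by
  obtain ⟨-, L, hL, hlink⟩ := h
  unfold committedLeaders at hL
  rw [List.mem_filterMap] at hL
  obtain ⟨s, hs, hsL⟩ := hL
  have hsm := List.takeWhile_subset _ hs
  have hsd : s.decision = .commit L := by
    cases hd : s.decision with
    | undecided => simp [hd, Decision.committed?] at hsL
    | skip => simp [hd, Decision.committed?] at hsL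
    | commit a =>
      simp only [hd, Decision.committed?, Option.some_inj] at hsL
      rw [hsL]
  refine ⟨s.round, fun R hR D₂ h₂ ⟨v, hv⟩ ⟨v', hv'⟩ => ?_⟩
  obtain ⟨w, hw, hwr, -, -⟩ := mem_tryDecide_of_direct hU h₂ c.one_le_leaders hv
  have g := round_rank_of_mem_tryDecide hsm
  have gw := round_rank_of_mem_tryDecide hw
  obtain ⟨s₂, hs₂, hr, hk⟩ := exists_mem_tryDecide (D := D₂) g.1 (by omega) g.2.2
  have dec : ∀ u ∈ tryDecide D₂, u.round < R → u.decision ≠ .undecided :=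
    fun u hu huR => decided_of_direct hU h₂ hv hv' hu huR
  have he := decision_unique hU h₁ h₂ hsm hs₂ hr.symm hk.symm (by rw [hsd]; simp)
    (dec s₂ hs₂ (by omega))
  rw [hsd] at he
  have hLD := (mem_of_decision_commit hU h₂ hs₂ he.symm).1
  obtain ⟨hlink', hb⟩ := hlink.transfer hU h₁ h₂ hLD
  refine ⟨hb, L, ?_, hlink'⟩
  unfold committedLeaders
  rw [List.mem_filterMap]
  refine ⟨s₂, mem_takeWhile_of_sorted (tryDecide_pairwise D₂) hs₂ ?_ ?_, ?_⟩
  · simpa using dec s₂ hs₂ (by omega)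
  · intro u hu hlt
    have : u.round < R := by
      unfold SlotDecision.Before at hlt
      omega
    simpa using dec u hu this
  · rw [← he]
    rfl

end SlotStates

/-! ### Invariants of executions -/

namespace Execution

variable {c : Config} {Tx : Type*} (E : Execution c Tx)

/-- The blocks that are proposed at some time in the execution. -/
def blocks : Set (Block c Tx) := {b | ∃ t p, E.action t = .propose p b}

theorem loc_succ_actor (t : ℕ) : (E.state (t + 1)).loc (E.action t).actor =
    ((E.state t).loc (E.action t).actor).next (E.action t) := by
  rw [E.state_succ]
  simp [GlobalState.next]

theorem loc_succ_of_ne {t : ℕ} {p : c.Replica} (h : p ≠ (E.action t).actor) :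
    (E.state (t + 1)).loc p = (E.state t).loc p := by
  rw [E.state_succ]
  simp [GlobalState.next, Function.update_of_ne h]

theorem loc_zero (p : c.Replica) : (E.state 0).loc p =
    { crashed := False, round := 0, timedOut := False, store := ∅, log := [] } := by
  rw [E.state_zero]
  rfl

theorem log_succ (t : ℕ) (p : c.Replica) :
    ((E.state (t + 1)).loc p).log = ((E.state t).loc p).log ∨
      ∃ b, ((E.state t).loc p).CanAdd b ∧
        ((E.state (t + 1)).loc p).log = ((E.state t).loc p).log ++ [b] := by
  by_cases hp : p = (E.action t).actor
  · have hl := E.loc_succ_actor t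
    have hg := E.guard t
    rw [← hp] at hl
    rw [hl]
    cases ha : E.action t with
    | add q b =>
      rw [ha] at hp hg
      have hpq : p = q := hp
      subst hpq
      exact Or.inr ⟨b, hg, rfl⟩
    | receive q q' m => cases m <;> exact Or.inl rfl
    | _ => exact Or.inl rfl
  · rw [E.loc_succ_of_ne hp]
    exact Or.inl rfl

theorem round_succ (t : ℕ) (p : c.Replica) :
    ((E.state (t + 1)).loc p).round = ((E.state t).loc p).round ∨
      ∃ b, E.action t = .propose p b ∧ b.round = ((E.state t).loc p).round + 1 ∧
        ((E.state (t + 1)).loc p).round = b.round := by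
  by_cases hp : p = (E.action t).actor
  · have hl := E.loc_succ_actor t
    have hg := E.guard t
    rw [← hp] at hl
    rw [hl]
    cases ha : E.action t with
    | propose q b =>
      rw [ha] at hp hg
      have hpq : p = q := hp
      subst hpq
      exact Or.inr ⟨b, rfl, hg.2.2.1, rfl⟩
    | receive q q' m => cases m <;> exact Or.inl rfl
    | _ => exact Or.inl rfl
  · rw [E.loc_succ_of_ne hp]
    exact Or.inl rfl

theorem store_succ (t : ℕ) (p : c.Replica) :
    ((E.state (t + 1)).loc p).store = ((E.state t).loc p).store ∨
      ∃ q b, E.action t = .receive p q (.block b) ∧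
        ((E.state (t + 1)).loc p).store = insert b ((E.state t).loc p).store := by
  by_cases hp : p = (E.action t).actor
  · have hl := E.loc_succ_actor t
    rw [← hp] at hl
    rw [hl]
    cases ha : E.action t with
    | receive q q' m =>
      rw [ha] at hp
      have hpq : p = q := hp
      subst hpq
      cases m with
      | block b => exact Or.inr ⟨q', b, rfl, rfl⟩
      | request x => exact Or.inl rfl
    | _ => exact Or.inl rfl
  · rw [E.loc_succ_of_ne hp]
    exact Or.inl rfl

theorem mem_log_mono (p : c.Replica) (b : Block c Tx) :
    Monotone fun t => b ∈ ((E.state t).loc p).log := by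
  refine monotone_nat_of_le_succ fun t h => ?_
  rcases E.log_succ t p with he | ⟨b', -, he⟩ <;> rw [he]
  · exact h
  · exact List.mem_append_left _ h

theorem has_mono (p : c.Replica) (x : c.Ref) : Monotone fun t => ((E.state t).loc p).Has x := by
  rintro t t' h ⟨b, hb, hx⟩
  exact ⟨b, E.mem_log_mono p b h hb, hx⟩

theorem round_mono (p : c.Replica) : Monotone fun t => ((E.state t).loc p).round := by
  refine monotone_nat_of_le_succ fun t => ?_
  rcases E.round_succ t p with he | ⟨b, -, hb, he⟩
  · exact he.ge
  · rw [he, hb]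
    exact Nat.le_succ _

theorem mem_store_mono (p : c.Replica) (b : Block c Tx) :
    Monotone fun t => b ∈ ((E.state t).loc p).store := by
  refine monotone_nat_of_le_succ fun t h => ?_
  rcases E.store_succ t p with he | ⟨q, b', -, he⟩ <;> rw [he]
  · exact h
  · exact Or.inr h

theorem mem_store_of_receive {t : ℕ} {p q : c.Replica} {b : Block c Tx}
    (h : E.action t = .receive p q (.block b)) : b ∈ ((E.state (t + 1)).loc p).store := by
  have hl := E.loc_succ_actor t
  rw [h] at hl
  have hl' : (E.state (t + 1)).loc p = ((E.state t).loc p).next (.receive p q (.block b)) := hl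
  rw [hl']
  exact Or.inl rfl

/-- All blocks in transit, received, or in a local DAG have been proposed. -/
theorem mem_blocks_invariant (t : ℕ) :
    (∀ p q b, (p, q, .block b) ∈ (E.state t).sent → b ∈ E.blocks) ∧
    (∀ p, ∀ b ∈ ((E.state t).loc p).store, b ∈ E.blocks) ∧
    (∀ p, ∀ b ∈ ((E.state t).loc p).log, b ∈ E.blocks) := by
  induction t with
  | zero =>
    refine ⟨fun p q b h => ?_, fun p b h => ?_, fun p b h => ?_⟩
    · rw [E.state_zero] at h
      exact absurd h (Set.notMem_empty _)
    · rw [E.loc_zero] at h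
      exact absurd h (Set.notMem_empty _)
    · rw [E.loc_zero] at h
      simp at h
  | succ t ih =>
    obtain ⟨ih₁, ih₂, ih₃⟩ := ih
    refine ⟨fun p q b h => ?_, fun p b h => ?_, fun p b h => ?_⟩
    · rw [E.state_succ] at h
      rcases h with h | h
      · exact ih₁ p q b h
      · cases ha : E.action t with
        | propose p' b' =>
          rw [ha] at h
          obtain ⟨q', he⟩ := h
          cases he
          exact ⟨t, _, ha⟩
        | receive p' q' m =>
          rw [ha] at h
          cases m with
          | block b' =>
            obtain ⟨x, -, -, he⟩ := h
            cases he
          | request x =>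
            obtain ⟨b', hb', -, he⟩ := h
            cases he
            exact ih₃ _ _ hb'
        | _ =>
          rw [ha] at h
          exact absurd h (Set.notMem_empty _)
    · rcases E.store_succ t p with he | ⟨q, b', ha, he⟩ <;> rw [he] at h
      · exact ih₂ p b h
      · rcases h with rfl | h
        · have hg := E.guard t
          rw [ha] at hg
          exact ih₁ _ _ _ hg
        · exact ih₂ p b h
    · rcases E.log_succ t p with he | ⟨b', hb', he⟩ <;> rw [he] at h
      · exact ih₃ p b h
      · rcases List.mem_append.1 h with h | h
        · exact ih₃ p b h
        · rw [List.mem_singleton.1 h]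
          exact ih₂ p b' hb'.1

theorem mem_blocks_of_mem_log {t : ℕ} {p : c.Replica} {b : Block c Tx}
    (h : b ∈ ((E.state t).loc p).log) : b ∈ E.blocks :=
  (E.mem_blocks_invariant t).2.2 p b h

theorem mem_blocks_of_receive {t : ℕ} {p q : c.Replica} {b : Block c Tx}
    (h : E.action t = .receive p q (.block b)) : b ∈ E.blocks := by
  have hg := E.guard t
  rw [h] at hg
  exact (E.mem_blocks_invariant t).1 _ _ _ hg

theorem log_closed (t : ℕ) (p : c.Replica) :
    ∀ b ∈ ((E.state t).loc p).log, ∀ x ∈ b.parents, ((E.state t).loc p).Has x := by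
  induction t with
  | zero => simp [E.loc_zero]
  | succ t ih =>
    intro b hb x hx
    refine E.has_mono p x (Nat.le_succ t) ?_
    rcases E.log_succ t p with he | ⟨b', hb', he⟩ <;> rw [he] at hb
    · exact ih b hb x hx
    · rcases List.mem_append.1 hb with h | h
      · exact ih b h x hx
      · rw [List.mem_singleton.1 h] at hx
        exact hb'.2.2 x hx

theorem log_nodup (t : ℕ) (p : c.Replica) : ((E.state t).loc p).log.Nodup := by
  induction t with
  | zero => simp [E.loc_zero]
  | succ t ih =>
    rcases E.log_succ t p with he | ⟨b', hb', he⟩ <;> rw [he]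
    · exact ih
    · exact List.nodup_append.2 ⟨ih, List.nodup_singleton _, by
        rintro a ha b hb rfl
        rw [List.mem_singleton.1 hb] at ha
        exact hb'.2.1 ha⟩

theorem guard_propose {t : ℕ} {p : c.Replica} {b : Block c Tx} (h : E.action t = .propose p b) :
    ((E.state t).loc p).Ready p ∧ ((E.state t).loc p).Legal p b := by
  have hg := E.guard t
  rw [h] at hg
  exact hg

theorem round_of_propose {t : ℕ} {p : c.Replica} {b : Block c Tx}
    (h : E.action t = .propose p b) : ((E.state (t + 1)).loc p).round = b.round := by
  have hl := E.loc_succ_actor t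
  rw [h] at hl
  have hl' : (E.state (t + 1)).loc p = ((E.state t).loc p).next (.propose p b) := hl
  rw [hl']
  rfl

theorem round_lt_of_propose {t t' : ℕ} {p : c.Replica} {b b' : Block c Tx}
    (h : E.action t = .propose p b) (h' : E.action t' = .propose p b') (hlt : t < t') :
    b.round < b'.round := by
  have h₁ : ((E.state (t + 1)).loc p).round ≤ ((E.state t').loc p).round := E.round_mono p hlt
  rw [E.round_of_propose h] at h₁
  have h₂ := (E.guard_propose h').2.2.1
  omega

theorem ref_injOn : Set.InjOn Block.ref E.blocks := by
  rintro b ⟨t, p, h⟩ b' ⟨t', p', h'⟩ he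
  have ha : b.author = b'.author := congrArg Prod.fst he
  have hr : b.round = b'.round := congrArg Prod.snd he
  have hpp : p = p' := by
    rw [← (E.guard_propose h).2.1, ← (E.guard_propose h').2.1, ha]
  subst hpp
  rcases lt_trichotomy t t' with hlt | rfl | hlt
  · exact absurd hr (E.round_lt_of_propose h h' hlt).ne
  · rw [h] at h'
    cases h'
    rfl
  · exact absurd hr (E.round_lt_of_propose h' h hlt).ne'

theorem mem_roundLog {t r : ℕ} {p : c.Replica} {b : Block c Tx} :
    b ∈ ((E.state t).loc p).roundLog r ↔ b ∈ ((E.state t).loc p).log ∧ b.round = r := by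
  simp [LocalState.roundLog]

/-- A replica proposes a block of round `r + 1 ≥ 2` only with `f + 1` blocks of round `r` in its
local DAG, the first `f + 1` of which it refers to. -/
theorem quorum_of_propose {t : ℕ} {p : c.Replica} {b : Block c Tx}
    (h : E.action t = .propose p b) {r : ℕ} (hr : 1 ≤ r) (hb : b.round = r + 1) :
    c.f + 1 ≤ (((E.state t).loc p).roundLog r).length ∧
      ∀ b' ∈ (((E.state t).loc p).roundLog r).take (c.f + 1), b'.ref ∈ b.parents := by
  obtain ⟨hready, -, hround, hpar, -⟩ := E.guard_propose h
  have hlr : ((E.state t).loc p).round = r := by omega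
  rw [hlr] at hpar
  refine ⟨?_, (hpar (by omega)).2⟩
  rcases hready with h0 | ⟨-, hq, -⟩
  · omega
  · rw [hlr] at hq
    exact hq

theorem isHistory_blocks : IsHistory E.blocks where
  ref_inj := E.ref_injOn
  round_pos := by
    rintro b ⟨t, p, h⟩
    have := (E.guard_propose h).2.2.1
    omega
  parents_lt := by
    rintro b ⟨t, p, h⟩ x hx
    exact ((E.guard_propose h).2.2.2.2 x hx).1
  quorum := by
    classical
    rintro b ⟨t, p, h⟩ hb
    obtain ⟨r, hr⟩ : ∃ r, b.round = r + 1 := ⟨b.round - 1, by omega⟩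
    obtain ⟨hq, hpar⟩ := E.quorum_of_propose h (by omega) hr
    set l := (((E.state t).loc p).roundLog r).take (c.f + 1) with hl
    have hmem : ∀ b' ∈ l, b' ∈ ((E.state t).loc p).log ∧ b'.round = r := fun b' hb' =>
      E.mem_roundLog.1 (List.mem_of_mem_take hb')
    have hnd : l.Nodup := ((E.log_nodup t p).filter _).sublist (List.take_sublist _ _)
    have hlen : l.toFinset.card = c.f + 1 := by
      rw [List.toFinset_card_of_nodup hnd, hl, List.length_take, min_eq_left hq]
    have himg : (l.toFinset.image Block.ref).card = c.f + 1 := by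
      rw [Finset.card_image_of_injOn, hlen]
      intro v hv w hw hvw
      exact E.ref_injOn (E.mem_blocks_of_mem_log (hmem v (List.mem_toFinset.1 hv)).1)
        (E.mem_blocks_of_mem_log (hmem w (List.mem_toFinset.1 hw)).1) hvw
    rw [← himg]
    refine Finset.card_le_card fun x hx => ?_
    obtain ⟨v, hv, rfl⟩ := Finset.mem_image.1 hx
    rw [List.mem_toFinset] at hv
    refine Finset.mem_filter.2 ⟨hpar v hv, ?_⟩
    have h1 : v.ref.2 = r := (hmem v hv).2
    rw [h1, hr]

theorem mem_dag {t : ℕ} {p : c.Replica} {b : Block c Tx} :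
    b ∈ ((E.state t).loc p).dag ↔ b ∈ ((E.state t).loc p).log := by
  simp [LocalState.dag]

theorem isLocalDag (t : ℕ) (p : c.Replica) :
    IsLocalDag E.blocks ((E.state t).loc p).dag where
  subset _ hb := E.mem_blocks_of_mem_log (E.mem_dag.1 hb)
  closed b hb x hx := by
    obtain ⟨b', hb', he⟩ := E.log_closed t p b (E.mem_dag.1 hb) x hx
    exact ⟨b', E.mem_dag.2 hb', he⟩

/-! ### Correct replicas exchange their blocks and propose in every round -/

open Filter

theorem eventually_atTop_of_monotone {P : ℕ → Prop} (hP : Monotone P) {t : ℕ} (h : P t) :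
    ∀ᶠ t' in atTop, P t' :=
  eventually_atTop.2 ⟨t, fun _ ht => hP ht h⟩

variable {E}

/-- Causal delivery: if `q` has the causal history of a block that it sends to `p`, then the
requests of `p` for missing blocks, all addressed to `q`, complete this history at `p`. -/
theorem Correct.eventually_mem_log_of_receive {p q : c.Replica} (hp : E.Correct p)
    (hq : E.Correct q) {b : Block c Tx} {t : ℕ} (h : E.action t = .receive p q (.block b))
    (hpar : ∀ x ∈ b.parents, ((E.state t).loc q).Has x) :
    ∀ᶠ t' in atTop, b ∈ ((E.state t').loc p).log := by
  induction hn : b.round using Nat.strong_induction_on generalizing b t with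
  | _ n ih =>
  subst hn
  have hall : ∀ x ∈ b.parents, ∀ᶠ t' in atTop, ((E.state t').loc p).Has x := by
    intro x hx
    by_cases hhas : ((E.state t).loc p).Has x
    · exact eventually_atTop_of_monotone (E.has_mono p x) hhas
    obtain ⟨t₁, ht₁, ha₁⟩ := E.delivery p q (.request x) t hp hq (by
      rw [h]
      exact ⟨x, hx, hhas, rfl⟩)
    obtain ⟨b', hb', hbx⟩ := E.has_mono q x ht₁.le (hpar x hx)
    obtain ⟨t₂, ht₂, ha₂⟩ := E.delivery q p (.block b') t₁ hq hp (by
      rw [ha₁]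
      exact ⟨b', hb', hbx, rfl⟩)
    have hlt : b'.round < b.round := by
      have := E.isHistory_blocks.parents_lt b (E.mem_blocks_of_receive h) x hx
      rwa [← hbx] at this
    refine (ih b'.round hlt ha₂ (fun y hy => ?_) rfl).mono fun t' ht' => ⟨b', ht', hbx⟩
    exact E.has_mono q y ht₂.le (E.log_closed t₁ q b' hb' y hy)
  obtain ⟨T, hT, hTt⟩ :=
    (((eventually_all_finset b.parents).2 hall).and (eventually_ge_atTop (t + 1))).exists
  by_cases hmem : b ∈ ((E.state T).loc p).log
  · exact eventually_atTop_of_monotone (E.mem_log_mono p b) hmem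
  · obtain ⟨t', -, ht'⟩ := E.adding p b T hp
      ⟨E.mem_store_mono p b hTt (E.mem_store_of_receive h), hmem, hT⟩
    exact eventually_atTop_of_monotone (E.mem_log_mono p b) ht'

theorem Correct.eventually_mem_log_of_propose {p q : c.Replica} (hp : E.Correct p)
    (hq : E.Correct q) {b : Block c Tx} {t : ℕ} (h : E.action t = .propose q b) :
    ∀ᶠ t' in atTop, b ∈ ((E.state t').loc p).log := by
  obtain ⟨t₁, ht₁, ha₁⟩ := E.delivery q p (.block b) t hq hp (by
    rw [h]
    exact ⟨p, rfl⟩)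
  exact hp.eventually_mem_log_of_receive hq ha₁ fun x hx =>
    E.has_mono q x ht₁.le ((E.guard_propose h).2.2.2.2 x hx).2

theorem exists_propose_of_le_round {t r : ℕ} {p : c.Replica} (hr : 1 ≤ r)
    (h : r ≤ ((E.state t).loc p).round) : ∃ t' b, E.action t' = .propose p b ∧ b.round = r := by
  induction t with
  | zero =>
    rw [E.loc_zero] at h
    have h₀ : r ≤ 0 := h
    omega
  | succ t ih =>
    rcases E.round_succ t p with he | ⟨b, ha, hb, he⟩
    · exact ih (he ▸ h)
    · by_cases hle : r ≤ ((E.state t).loc p).round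
      · exact ih hle
      · exact ⟨t, b, ha, by omega⟩

open Classical in
theorem card_correct (E : Execution c Tx) :
    c.f + 1 ≤ (Finset.univ.filter fun p => E.Correct p).card := by
  have h := E.faults
  have he : {p | ∃ t, ((E.state t).loc p).crashed} =
      ((Finset.univ.filter fun p => ¬ E.Correct p : Finset c.Replica) : Set c.Replica) := by
    ext p
    simp [Correct]
  rw [he, Set.ncard_coe_finset] at h
  have := Finset.card_filter_add_card_filter_not (s := (Finset.univ : Finset c.Replica))
    (fun p => E.Correct p)
  rw [Finset.card_univ, Fintype.card_fin] at this
  omega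

theorem le_length_roundLog {t r : ℕ} {p : c.Replica} {C : Finset c.Replica}
    (h : ∀ q ∈ C, ((E.state t).loc p).Has (q, r)) :
    C.card ≤ (((E.state t).loc p).roundLog r).length := by
  classical
  calc C.card ≤ ((((E.state t).loc p).roundLog r).map Block.author).toFinset.card := by
        refine Finset.card_le_card fun q hq => ?_
        obtain ⟨b, hb, he⟩ := h q hq
        rw [List.mem_toFinset, List.mem_map]
        exact ⟨b, E.mem_roundLog.2 ⟨hb, congrArg Prod.snd he⟩, congrArg Prod.fst he⟩
    _ ≤ _ := (List.toFinset_card_le _).trans (List.length_map _).le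

/-- Every correct replica proposes in every round: once all correct replicas have proposed in a
round, their blocks and the timeout allow each of them to go on. -/
theorem Correct.exists_round_ge {p : c.Replica} (hp : E.Correct p) (r : ℕ) :
    ∃ t, r ≤ ((E.state t).loc p).round := by
  classical
  induction r generalizing p with
  | zero => exact ⟨0, Nat.zero_le _⟩
  | succ r ih =>
    obtain ⟨t₀, ht₀⟩ := ih hp
    have hready : ∃ t, r ≤ ((E.state t).loc p).round ∧
        (((E.state t).loc p).round = r → ((E.state t).loc p).Ready p) := by
      rcases Nat.eq_zero_or_pos r with rfl | hr
      · exact ⟨t₀, ht₀, fun h => Or.inl h⟩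
      have hall : ∀ q ∈ Finset.univ.filter fun q => E.Correct q,
          ∀ᶠ t in atTop, ((E.state t).loc p).Has (q, r) := by
        intro q hq
        have hq := (Finset.mem_filter.1 hq).2
        obtain ⟨t₁, ht₁⟩ := ih hq
        obtain ⟨t₂, b, hb, hbr⟩ := exists_propose_of_le_round hr ht₁
        refine (hp.eventually_mem_log_of_propose hq hb).mono fun t ht => ⟨b, ht, ?_⟩
        exact Prod.ext (E.guard_propose hb).2.1 hbr
      obtain ⟨T, hT, hTt⟩ :=
        (((eventually_all_finset _).2 hall).and (eventually_ge_atTop t₀)).exists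
      obtain ⟨t', ht', htime⟩ := E.timing p T hp
      have hrT : r ≤ ((E.state T).loc p).round := ht₀.trans (E.round_mono p hTt)
      refine ⟨t', hrT.trans (E.round_mono p ht'), fun heq => Or.inr ?_⟩
      have hhas : ∀ q ∈ Finset.univ.filter fun q => E.Correct q,
          ((E.state t').loc p).Has (q, r) := fun q hq => E.has_mono p _ ht' (hT q hq)
      rw [heq]
      refine ⟨hhas p (by simpa using hp), E.card_correct.trans (le_length_roundLog hhas), ?_⟩
      rcases htime with h | h
      · exact Or.inr h
      · omega
    obtain ⟨t, hle, hrd⟩ := hready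
    rcases hle.eq_or_lt with heq | hlt
    · obtain ⟨t', -, ht'⟩ := E.proposing p t hp (hrd heq.symm)
      exact ⟨t', by omega⟩
    · exact ⟨t, hlt⟩

theorem Correct.exists_propose {p : c.Replica} (hp : E.Correct p) {r : ℕ} (hr : 1 ≤ r) :
    ∃ t b, E.action t = .propose p b ∧ b.round = r := by
  obtain ⟨t, ht⟩ := hp.exists_round_ge r
  exact exists_propose_of_le_round hr ht

/-! ### Favourable rounds -/

/-- If all orders of round `R` put a correct replica `x` first, then every block of round `R + 1`
of a correct replica refers to the block of round `R` of `x`. -/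
theorem Follows.ref_mem_parents {π : c.Replica → ℕ → Equiv.Perm c.Replica} (hF : E.Follows π)
    {R : ℕ} (hR : 1 ≤ R) {x : c.Replica} (hx : E.Correct x) (hfirst : ∀ p, π p R x = 0)
    {p : c.Replica} (hp : E.Correct p) {t : ℕ} {b : Block c Tx} (h : E.action t = .propose p b)
    (hb : b.round = R + 1) : (x, R) ∈ b.parents := by
  classical
  obtain ⟨hq, hpar⟩ := E.quorum_of_propose h hR hb
  have hset := hF p R t hq
  have hxa : x ∈ E.authors p R := by
    obtain ⟨t₁, v, hv, hvr⟩ := hx.exists_propose hR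
    obtain ⟨t₂, ht₂⟩ := (hp.eventually_mem_log_of_propose hx hv).exists
    unfold authors
    exact Finset.mem_filter.2 ⟨Finset.mem_univ _, t₂, v, ht₂,
      Prod.ext (E.guard_propose hv).2.1 hvr⟩
  have hxm : x ∈ (((((E.state t).loc p).roundLog R).take (c.f + 1)).map
      Block.author).toFinset := by
    rw [hset]
    refine Finset.mem_filter.2 ⟨hxa, ?_⟩
    rw [Finset.filter_false_of_mem]
    · exact Nat.succ_pos _
    · intro y _
      rw [hfirst]
      exact Fin.not_lt_zero _
  rw [List.mem_toFinset, List.mem_map] at hxm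
  obtain ⟨v, hv, hvx⟩ := hxm
  have hvr := (E.mem_roundLog.1 (List.mem_of_mem_take hv)).2
  have := hpar v hv
  rwa [show v.ref = (x, R) from Prod.ext hvx hvr] at this

theorem Follows.eventually_tryDirectDecide {π : c.Replica → ℕ → Equiv.Perm c.Replica}
    (hF : E.Follows π) {R : ℕ} (hR : 1 ≤ R) (hx : E.Correct (c.leader R 0))
    (hfirst : ∀ p, π p R (c.leader R 0) = 0) {q : c.Replica} (hq : E.Correct q) :
    ∀ᶠ t in atTop, ∃ v, tryDirectDecide ((E.state t).loc q).dag R 0 = .commit v := by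
  classical
  obtain ⟨t₀, b, hb, hbR⟩ := hx.exists_propose hR
  have hba := (E.guard_propose hb).2.1
  have hvote : ∀ p : c.Replica, ∃ v : Block c Tx, E.Correct p →
      v.author = p ∧ v.round = R + 1 ∧ b.ref ∈ v.parents ∧
        ∀ᶠ t in atTop, v ∈ ((E.state t).loc q).log := by
    intro p
    by_cases hp : E.Correct p
    · obtain ⟨t, v, hv, hvr⟩ := hp.exists_propose (Nat.succ_pos R)
      refine ⟨v, fun _ => ⟨(E.guard_propose hv).2.1, hvr, ?_,
        hq.eventually_mem_log_of_propose hp hv⟩⟩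
      rw [show b.ref = (c.leader R 0, R) from Prod.ext hba hbR]
      exact hF.ref_mem_parents hR hx hfirst hp hv hvr
    · exact ⟨b, fun h => absurd h hp⟩
  choose v hv using hvote
  have hall : ∀ p ∈ Finset.univ.filter fun p => E.Correct p,
      ∀ᶠ t in atTop, v p ∈ ((E.state t).loc q).log := fun p hp =>
    (hv p (Finset.mem_filter.1 hp).2).2.2.2
  filter_upwards [(eventually_all_finset _).2 hall, hq.eventually_mem_log_of_propose hx hb]
    with t ht htb
  have hlead : leaderBlock ((E.state t).loc q).dag R 0 = some b :=
    (leaderBlock_eq_some E.isHistory_blocks (E.isLocalDag t q)).2 ⟨E.mem_dag.2 htb, hbR, hba⟩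
  have hsup : SupportedLeader ((E.state t).loc q).dag R b := by
    unfold SupportedLeader
    refine E.card_correct.trans ?_
    refine Finset.card_le_card_of_injOn v (fun p hp => ?_) (fun p hp p' hp' he => ?_)
    · have hp' := hv p (Finset.mem_filter.1 hp).2
      have hm := E.mem_dag.2 (ht p hp)
      exact Finset.mem_filter.2 ⟨hm, hp'.2.1,
        Relation.ReflTransGen.single ⟨hm, E.mem_dag.2 htb, hp'.2.2.1⟩⟩
    · rw [← (hv p (Finset.mem_filter.1 hp).2).1, ← (hv p' (Finset.mem_filter.1 hp').2).1, he]
  exact ⟨b, by simp [tryDirectDecide, hlead, hsup]⟩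

/-- A majority of the replicas is correct, so two cyclically consecutive ones are. -/
theorem exists_consecutive_correct (E : Execution c Tx) :
    ∃ a : Fin (2 * c.f + 1), E.Correct (c.nodes a) ∧ E.Correct (c.nodes (a + 1)) := by
  classical
  by_contra! hno
  set C := Finset.univ.filter fun a => E.Correct (c.nodes a) with hC
  have hcard : c.f + 1 ≤ C.card := by
    refine E.card_correct.trans ?_
    refine Finset.card_le_card_of_injOn c.nodes.symm (fun p hp => ?_) c.nodes.symm.injective.injOn
    have := (Finset.mem_filter.1 hp).2
    simpa [hC] using this
  have hd : Disjoint C (C.image fun a => a + 1) := by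
    rw [Finset.disjoint_left]
    intro y hy hy'
    obtain ⟨a, ha, rfl⟩ := Finset.mem_image.1 hy'
    exact hno a (Finset.mem_filter.1 ha).2 (Finset.mem_filter.1 hy).2
  have h := Finset.card_union_of_disjoint hd
  rw [Finset.card_image_of_injective _ (add_left_injective 1)] at h
  have h' := Finset.card_le_univ (C ∪ C.image fun a => a + 1)
  rw [Fintype.card_fin] at h'
  omega

/-- The deterministic core of agreement: it suffices that, for each position `a` in the enumeration
of the replicas, there are arbitrarily high pairs of consecutive rounds, the first congruent to `a`
modulo the number of replicas, in which all orders put the first leader first. -/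
theorem Follows.commits_of_commits {π : c.Replica → ℕ → Equiv.Perm c.Replica} (hF : E.Follows π)
    (hgood : ∀ a : Fin (2 * c.f + 1), ∀ m, ∃ R > m, R % (2 * c.f + 1) = a ∧
      ∀ p, π p R (c.leader R 0) = 0 ∧ π p (R + 1) (c.leader (R + 1) 0) = 0)
    {p q : c.Replica} (hq : E.Correct q) {b : Block c Tx} (h : E.Commits p b) :
    E.Commits q b := by
  obtain ⟨t, ht⟩ := h
  obtain ⟨r, hr⟩ := ht.exists_transfer E.isHistory_blocks (E.isLocalDag t p)
  obtain ⟨a, ha, ha'⟩ := E.exists_consecutive_correct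
  obtain ⟨R, hR, hmod, hfirst⟩ := hgood a r
  have e : c.leader R 0 = c.nodes a := by
    unfold Config.leader
    exact congrArg _ (Fin.ext hmod)
  have e' : c.leader (R + 1) 0 = c.nodes (a + 1) := by
    unfold Config.leader
    refine congrArg _ (Fin.ext ?_)
    rw [Fin.val_add, ← hmod, Fin.val_one', ← Nat.add_mod]
  obtain ⟨T, h₁, h₂⟩ := ((hF.eventually_tryDirectDecide (by omega) (e ▸ ha)
    (fun p => (hfirst p).1) hq).and (hF.eventually_tryDirectDecide (by omega) (e' ▸ ha')
    (fun p => (hfirst p).2) hq)).exists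
  exact ⟨T, hr R hR _ (E.isLocalDag T q) h₁ h₂⟩

end Execution

/-! ### Favourable rounds recur almost surely -/

open Filter in
/-- Second Borel–Cantelli lemma for joint occurrences of independent events: if the finite sets `S k`
are disjoint and the probability that all events of `S k` occur is bounded below, then almost surely
this happens for infinitely many `k`. -/
theorem frequently_forall_mem_of_iIndepSet {Ω ι : Type*} [MeasurableSpace Ω] {μ : Measure Ω}
    [IsProbabilityMeasure μ] {A : ι → Set Ω} (hA : ∀ i, MeasurableSet (A i))
    (hind : iIndepSet A μ) {S : ℕ → Finset ι} (hS : Pairwise fun j k => Disjoint (S j) (S k))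
    {ε : ENNReal} (hε : ε ≠ 0) (hμ : ∀ k, ε ≤ ∏ i ∈ S k, μ (A i)) :
    ∀ᵐ ω ∂μ, ∃ᶠ k in atTop, ∀ i ∈ S k, ω ∈ A i := by
  classical
  set B : ℕ → Set Ω := fun k => ⋂ i ∈ S k, A i with hB
  have hBm : ∀ k, MeasurableSet (B k) := fun k => (S k).measurableSet_biInter fun i _ => hA i
  have hBμ : ∀ k, μ (B k) = ∏ i ∈ S k, μ (A i) := fun k => hind.meas_biInter (S k)
  have hBind : iIndepSet B μ := by
    rw [iIndepSet_iff_meas_biInter hBm]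
    intro s
    have hU : ⋂ k ∈ s, B k = ⋂ i ∈ s.biUnion S, A i := by
      ext ω
      simp only [hB, Set.mem_iInter, Finset.mem_biUnion]
      exact ⟨fun h i ⟨k, hk, hi⟩ => h k hk i hi, fun h k hk i hi => h i ⟨k, hk, hi⟩⟩
    rw [hU, hind.meas_biInter, Finset.prod_biUnion fun j _ k _ hjk => hS hjk]
    exact Finset.prod_congr rfl fun k _ => (hBμ k).symm
  have hsum : ∑' k, μ (B k) = ⊤ := by
    refine top_unique ?_
    rw [← ENNReal.tsum_const_eq_top_of_ne_zero (α := ℕ) hε]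
    exact ENNReal.tsum_le_tsum fun k => (hBμ k).symm ▸ hμ k
  have hone := measure_limsup_eq_one hBm hBind hsum
  have hae : ∀ᵐ ω ∂μ, ω ∈ limsup B atTop :=
    (mem_ae_iff_prob_eq_one (MeasurableSet.measurableSet_limsup hBm)).2 hone
  filter_upwards [hae] with ω hω
  rw [mem_limsup_iff_frequently_mem] at hω
  exact hω.mono fun k hk => by simpa [hB] using hk

/-- In a random schedule, almost surely, each position `a` is the residue of arbitrarily high rounds
`R` such that all orders of the rounds `R` and `R + 1` put the first leader first. -/
theorem IsRandomSchedule.exists_favourable_rounds (c : Config) {Ω : Type*} [MeasurableSpace Ω]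
    {μ : Measure Ω} [IsProbabilityMeasure μ] {π : c.Replica → ℕ → Ω → Equiv.Perm c.Replica}
    (hπ : IsRandomSchedule c μ π) :
    ∀ᵐ ω ∂μ, ∀ a : Fin (2 * c.f + 1), ∀ m, ∃ R > m, R % (2 * c.f + 1) = a ∧
      ∀ p, π p R ω (c.leader R 0) = 0 ∧ π p (R + 1) ω (c.leader (R + 1) 0) = 0 := by
  classical
  rw [ae_all_iff]
  intro a
  obtain ⟨n, hn⟩ : ∃ n, n = 2 * c.f + 1 := ⟨_, rfl⟩
  -- It suffices that every order is one fixed permutation that puts the leader first.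
  let A : c.Replica × ℕ → Set Ω := fun i => {ω | π i.1 i.2 ω = Equiv.swap (c.leader i.2 0) 0}
  have hA : ∀ i, MeasurableSet (A i) := fun i =>
    hπ.measurable i.1 i.2 (t := {Equiv.swap (c.leader i.2 0) 0}) trivial
  have hAμ : ∀ i, μ (A i) = (Fintype.card (Equiv.Perm c.Replica) : ENNReal)⁻¹ :=
    fun i => hπ.uniform _ _ _
  have hind : iIndepSet A μ := by
    rw [iIndepSet_iff_meas_biInter hA]
    intro s
    exact hπ.indep.measure_inter_preimage_eq_mul s
      (sets := fun i => {Equiv.swap (c.leader i.2 0) 0}) fun _ _ => trivial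
  let R : ℕ → ℕ := fun k => a + n * (2 * k + 1)
  have hR : ∀ {j k}, j < k → R j + 1 < R k := by
    intro j k hjk
    have h : n * (2 * j + 3) ≤ n * (2 * k + 1) := Nat.mul_le_mul_left n (by omega)
    have h' : n * (2 * j + 3) = n * (2 * j + 1) + 2 * n := by ring
    change a + n * (2 * j + 1) + 1 < a + n * (2 * k + 1)
    omega
  let S : ℕ → Finset (c.Replica × ℕ) := fun k => Finset.univ ×ˢ {R k, R k + 1}
  have hS : Pairwise fun j k => Disjoint (S j) (S k) := by
    intro j k hjk
    rw [Finset.disjoint_left]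
    rintro ⟨p, r⟩ h h'
    simp only [S, Finset.mem_product, Finset.mem_univ, true_and, Finset.mem_insert,
      Finset.mem_singleton] at h h'
    rcases lt_or_gt_of_ne hjk with hlt | hlt
    · have := hR hlt
      omega
    · have := hR hlt
      omega
  have hcard : ∀ k, (S k).card = n * 2 := fun k => by
    rw [Finset.card_product, Finset.card_pair (Nat.succ_ne_self _).symm, Finset.card_univ,
      Fintype.card_fin, hn]
  have hfreq := frequently_forall_mem_of_iIndepSet hA hind hS
    (ε := (Fintype.card (Equiv.Perm c.Replica) : ENNReal)⁻¹ ^ (n * 2))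
    (pow_ne_zero _ (ENNReal.inv_ne_zero.2 (ENNReal.natCast_ne_top _))) fun k => by
      rw [Finset.prod_congr rfl fun i _ => hAμ i, Finset.prod_const, hcard]
  filter_upwards [hfreq] with ω hω m
  obtain ⟨k, hk, hall⟩ := Filter.frequently_atTop.1 hω m
  have hle : 1 * (2 * k + 1) ≤ n * (2 * k + 1) := Nat.mul_le_mul_right _ (by omega)
  refine ⟨R k, ?_, ?_, fun p => ⟨?_, ?_⟩⟩
  · change m < a + n * (2 * k + 1)
    omega
  · change (a + n * (2 * k + 1)) % (2 * c.f + 1) = a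
    rw [hn, Nat.add_mul_mod_self_left, Nat.mod_eq_of_lt a.isLt]
  · have h : π p (R k) ω = Equiv.swap (c.leader (R k) 0) 0 := hall (p, R k) (by simp [S])
    rw [h, Equiv.swap_apply_left]
  · have h : π p (R k + 1) ω = Equiv.swap (c.leader (R k + 1) 0) 0 :=
      hall (p, R k + 1) (by simp [S])
    rw [h, Equiv.swap_apply_left]

theorem mainTheorem6 {Tx : Type*} (c : Config) {Ω : Type*} [MeasurableSpace Ω] (μ : Measure Ω)
    [IsProbabilityMeasure μ] (π : c.Replica → ℕ → Ω → Equiv.Perm c.Replica)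
    (hπ : IsRandomSchedule c μ π) (E : Ω → Execution c Tx)
    (hE : ∀ᵐ ω ∂μ, (E ω).Follows fun p r => π p r ω) :
    ∀ᵐ ω ∂μ, ∀ p b, (E ω).Correct p → (E ω).Commits p b →
      ∀ q, (E ω).Correct q → (E ω).Commits q b := by
  filter_upwards [hE, hπ.exists_favourable_rounds] with ω hF hgood p b _ hpb q hq
  exact hF.commits_of_commits hgood hq hpb
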